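/- A topological space is scattered if each of its non-empty subspaces has an isolated point. For a space $X$ put $X^{(0)}=X$ and, for each ordinal $\alpha>0$, $X^{(\alpha)}=\bigcap_{\beta<\alpha}(X^{(\beta)})'$, where $A'$ denotes the set of non-isolated points of the subspace $A$. If $X$ is scattered, then for each $x\in X$ there is a unique ordinal $h(x)$ with $x\in X^{(h(x))}\setminus X^{(h(x)+1)}$, and the scattered height of $X$ is the ordinal $h(X)=\sup\{h(x):x\in X\}$. For a partially ordered set $P$, a space $X$ has a $P$-base if for each $x\in X$ there is a neighbourhood base $(U_p[x])_{p\in P}$ at $x$ such that $U_p[x]\subseteq U_{p'}[x]$ whenever $p\ge p'$ in $P$. For a separable metric space $M$, let $\mathcal K(M)$ be the collection of all compact subsets of $M$, ordered by inclusion. **Proposition.** Let $X$ be a compact Hausdorff scattered space whose scattered height is a countable ordinal, and suppose that $X$ has a $\mathcal K(M)$-base for some separable metric space $M$. Then $X$ is countable, and hence metrizable. -/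

import Mathlib

universe u v

/-- A topological space is scattered if each non-empty subspace has an isolated point. -/
def IsScattered (X : Type u) [TopologicalSpace X] : Prop :=
  ∀ A : Set X, A.Nonempty → ∃ x ∈ A, ∃ U : Set X, IsOpen U ∧ U ∩ A = {x}

/-- The `a`-th Cantor–Bendixson derivative `X^(a)` of the space `X`: one has `X^(0) = X`, and
`X^(a)` is the intersection over `b < a` of the set of non-isolated points of `X^(b)`. -/
noncomputable def cbDerivative (X : Type u) [TopologicalSpace X] (a : Ordinal.{u}) : Set X :=
  CantorBendixson.iteratedDerivedSet Set.univ a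

/-- The height `h(x)` of a point of a scattered space: the unique ordinal `a` such that
`x ∈ X^(a) \ X^(a + 1)` (see `IsScattered.mem_cbDerivative_diff_iff`). -/
noncomputable def pointHeight {X : Type u} [TopologicalSpace X] (x : X) : Ordinal.{u} :=
  sInf {a | x ∈ cbDerivative X a \ cbDerivative X (a + 1)}

/-- The scattered height `h(X) = sup {h(x) : x ∈ X}` of a scattered space. The supremum is that
of a small, hence bounded, family of ordinals. -/
noncomputable def scatteredHeight (X : Type u) [TopologicalSpace X] : Ordinal.{u} :=
  ⨆ x : X, pointHeight x

/-- `X` has a neighbourhood `P`-base at `x`: a neighbourhood base `(U p)` at `x` indexed by `P`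
such that `U q ⊆ U p` whenever `p ≤ q`. -/
def HasPBaseAt (P : Type v) [PartialOrder P] {X : Type u} [TopologicalSpace X] (x : X) : Prop :=
  ∃ U : P → Set X, (nhds x).HasBasis (fun _ => True) U ∧ ∀ p q : P, p ≤ q → U q ⊆ U p

/-- `X` has a `P`-base if it has a neighbourhood `P`-base at each point. -/
def HasPBase (P : Type v) [PartialOrder P] (X : Type u) [TopologicalSpace X] : Prop :=
  ∀ x : X, HasPBaseAt P x

theorem cbDerivative_eq (X : Type u) [TopologicalSpace X] (a : Ordinal.{u}) :
    cbDerivative X a =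
      ⋂ b < a, {x ∈ cbDerivative X b | AccPt x (Filter.principal (cbDerivative X b))} := by
  unfold cbDerivative CantorBendixson.iteratedDerivedSet
  conv_lhs => rw [OrdinalApprox.gfpApprox]
  ext x
  simp [derivedSet, and_comm]

theorem IsScattered.exists_mem_cbDerivative_diff {X : Type u} [TopologicalSpace X]
    (hX : IsScattered X) (x : X) :
    ∃ a, x ∈ cbDerivative X a \ cbDerivative X (a + 1) := by
  by_contra! h
  have hall : ∀ a : Ordinal.{u}, x ∈ cbDerivative X a := by
    intro a
    induction a using Ordinal.limitRecOn with
    | zero => simp [cbDerivative]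
    | add_one a ih => by_contra h'; exact h a ⟨ih, h'⟩
    | limit a ha ih =>
      simp only [cbDerivative] at ih ⊢
      rw [CantorBendixson.iteratedDerivedSet_limit ha]
      simpa using ih
  obtain ⟨a, ha⟩ := CantorBendixson.iteratedDerivedSet_mem_fixedPoints (Set.univ : Set X)
  change relDerivedSet (cbDerivative X a) = cbDerivative X a at ha
  obtain ⟨y, hy, U, hU, hUA⟩ := hX _ ⟨x, hall a⟩
  have hyU : y ∈ U ∩ cbDerivative X a := by rw [hUA]; rfl
  have hacc : y ∈ relDerivedSet (cbDerivative X a) := ha.symm ▸ hy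
  obtain ⟨z, hz, hne⟩ := accPt_iff_nhds.mp hacc.1 U (hU.mem_nhds hyU.1)
  rw [hUA] at hz
  exact hne hz

/-- In a scattered space `h(x)` is the unique ordinal `a` with `x ∈ X^(a) \ X^(a + 1)`. -/
theorem IsScattered.mem_cbDerivative_diff_iff {X : Type u} [TopologicalSpace X]
    (hX : IsScattered X) (x : X) (a : Ordinal.{u}) :
    x ∈ cbDerivative X a \ cbDerivative X (a + 1) ↔ pointHeight x = a := by
  have hmem : x ∈ cbDerivative X (pointHeight x) \ cbDerivative X (pointHeight x + 1) :=
    csInf_mem (hX.exists_mem_cbDerivative_diff x)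
  have anti : Antitone (cbDerivative X) :=
    CantorBendixson.iteratedDerivedSet_antitone _
  constructor
  · intro h
    apply le_antisymm
    · exact csInf_le' h
    · by_contra! hlt
      exact hmem.2 (anti (Order.add_one_le_of_lt hlt) h.1)
  · rintro rfl
    exact hmem

/-!
The argument shows by induction on the height that every point `x` of `X` has a countable
neighbourhood; compactness then makes `X` countable, and a countable compact Hausdorff space is
first countable, hence second countable, hence metrizable.

For the inductive step, let `V` be a closed neighbourhood of `x` all of whose other points have
smaller height, so that these have countable neighbourhoods, and let `U` be the base at `x`
indexed by `𝒦(M)`. If compact sets `Q j` shrink towards a compact set `p`, then `p ∪ ⋃ j, Q j` is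
compact. Hence points `y j` omitted by `U (Q j)` are all omitted by one member of the base and do
not accumulate at `x` (`exists_forall_notMem_of_thickening`). Let `D n` be the set of
points of `V` omitted by `U q` for some `q` within `1 / (n + 1)` of `p`, and let `C` consist of the
points other than `x` in the closures of all `D n`. The points of `C` have countable
neighbourhood bases, so a diagonal form of the observation shows that no countable subset of `C`
accumulates at `x`.

Such a set `C` is countable, and this is where the countable height enters
(`countable_of_forall_countable_subset_notMem_closure`): let `b` be the least
ordinal such that the `b`-th derivative meets `C` in a countable set, and suppose `b ≠ 0`.
Away from a countable open set, `C` misses the `b`-th derivative but meets all earlier ones in uncountable sets; as `b` is countable,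
a sequence of distinct points of `C` can be chosen that is eventually in each earlier derivative,
and its cluster points, still in `C` and away from that open set, lie in the `b`-th one,
a contradiction. Hence `b = 0` and `C` is countable. So `C` lies in a countable open set, and by the same
observation `D n` lies in it for some `n` (`exists_countable_omittedPoints_thickening`).

Thus each compact `p` has a neighbourhood in `M` whose compact subsets `q` account, through the
complements of the `U q`, for countably many points of `V` only. As `M` is second countable,
countably many such neighbourhoods, finite unions of basic open sets, catch every compact `p`,
and `V` is countable (`countable_of_countable_omittedPoints_thickening`).
-/

open Set Filter Topology TopologicalSpace

/-! ### Compact subsets of a metric space -/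

/-- Compact sets that shrink towards a compact set `p` have, together with `p`, a compact union. -/
theorem isCompact_union_iUnion_of_subset_thickening {M : Type*} [PseudoMetricSpace M]
    {p : Set M} (hp : IsCompact p) {Q : ℕ → Set M} (hQ : ∀ j, IsCompact (Q j))
    (hQp : ∀ j : ℕ, Q j ⊆ Metric.thickening (1 / ((j : ℝ) + 1)) p) :
    IsCompact (p ∪ ⋃ j, Q j) := by
  rw [isCompact_iff_ultrafilter_le_nhds']
  intro f hf
  by_cases hex : ∃ j, Q j ∈ f
  · obtain ⟨j, hj⟩ := hex
    obtain ⟨a, ha, hfa⟩ := isCompact_iff_ultrafilter_le_nhds'.1 (hQ j) f hj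
    exact ⟨a, Or.inr (mem_iUnion.2 ⟨j, ha⟩), hfa⟩
  push Not at hex
  -- A set of `f` misses any given finite number of the `Q j`, so it lies close to `p`.
  have hthick : ∀ n : ℕ, Metric.thickening (1 / ((n : ℝ) + 1)) p ∈ f := by
    intro n
    have hfin : ∀ᶠ y in (f : Filter M), ∀ j ∈ Iio n, y ∉ Q j :=
      (eventually_all_finite (finite_Iio n)).2 fun j _ => Ultrafilter.compl_mem_iff_notMem.2 (hex j)
    filter_upwards [hf, hfin] with y hy hyn
    rcases hy with hy | hy
    · exact Metric.self_subset_thickening (by positivity) p hy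
    · obtain ⟨j, hj⟩ := mem_iUnion.1 hy
      have hnj : n ≤ j := by
        by_contra! h
        exact hyn j h hj
      refine Metric.thickening_mono ?_ p (hQp j hj)
      gcongr
  suffices ∃ a ∈ p, (f : Filter M) ≤ 𝓝 a by
    obtain ⟨a, ha, hfa⟩ := this
    exact ⟨a, Or.inl ha, hfa⟩
  by_contra! hno
  have hN : ∀ a ∈ p, ∃ N, a ∈ N ∧ IsOpen N ∧ N ∉ f := by
    intro a ha
    by_contra! h
    exact hno a ha ((nhds_basis_opens a).ge_iff.2 fun N hN => h N hN.1 hN.2)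
  choose! N hNa hNo hNf using hN
  obtain ⟨t, htp, ht, hpt⟩ := hp.elim_finite_subcover_image (b := p) hNo
    fun a ha => mem_biUnion ha (hNa a ha)
  obtain ⟨δ, hδ, hδt⟩ := hp.exists_thickening_subset_open
    (isOpen_biUnion fun a ha => hNo a (htp ha)) hpt
  obtain ⟨n, hn⟩ := exists_nat_one_div_lt hδ
  have hmem : (⋃ a ∈ t, N a) ∈ f :=
    mem_of_superset (hthick n) ((Metric.thickening_mono hn.le p).trans hδt)
  obtain ⟨a, ha, hfa⟩ := (Ultrafilter.finite_biUnion_mem_iff ht).1 hmem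
  exact hNf a (htp ha) hfa

/-- The order property of `𝒦(M)` behind the argument: a doubly indexed family of points, the
`(k, j)`-th of which for `k ≤ j` is omitted by some `U q` with `q` within `1 / (j + 1)` of `p`, is
omitted by a single member of the base. Only finitely many indices belong to each `j`, so the
compact sets involved have an upper bound in `𝒦(M)`. -/
theorem exists_forall_notMem_of_thickening {X M : Type*} [PseudoMetricSpace M]
    {U : Compacts M → Set X} (hU : ∀ p q, p ≤ q → U q ⊆ U p) (p : Compacts M) (z : ℕ → ℕ → X)
    (hz : ∀ k j : ℕ, k ≤ j → ∃ q : Compacts M,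
      (q : Set M) ⊆ Metric.thickening (1 / ((j : ℝ) + 1)) (p : Set M) ∧ z k j ∉ U q) :
    ∃ q, ∀ k j, k ≤ j → z k j ∉ U q := by
  choose! q hq hzq using hz
  have hc := isCompact_union_iUnion_of_subset_thickening p.isCompact
    (Q := fun j => ⋃ k ∈ Iic j, (q k j : Set M))
    (fun j => (finite_Iic j).isCompact_biUnion fun k _ => (q k j).isCompact)
    (fun j => iUnion₂_subset fun k hk => hq k j hk)
  refine ⟨⟨_, hc⟩, fun k j hkj hmem => hzq k j hkj (hU _ _ ?_ hmem)⟩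
  intro a ha
  exact Or.inr (mem_iUnion.2 ⟨j, mem_biUnion (show k ∈ Iic j from hkj) ha⟩)

/-! ### Points with a countable neighbourhood -/

theorem isCountablyGenerated_nhds_of_countable_mem_nhds {X : Type*} [TopologicalSpace X]
    [CompactSpace X] [T2Space X] {y : X} {W : Set X} (hW : W ∈ 𝓝 y) (hWc : W.Countable) :
    (𝓝 y).IsCountablyGenerated := by
  obtain ⟨K, hK, hKcl, hKW⟩ := exists_mem_nhds_isClosed_subset hW
  have hsep : ∀ w : X, w ≠ y → ∃ V : Set X, IsOpen V ∧ w ∈ V ∧ Vᶜ ∈ 𝓝 y := by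
    intro w hwy
    obtain ⟨V, V', hV, hV', hwV, hyV', hd⟩ := t2_separation hwy
    exact ⟨V, hV, hwV, mem_of_superset (hV'.mem_nhds hyV') hd.subset_compl_left⟩
  choose! V hVo hwV hVy using hsep
  have : Countable ↥(K \ {y}) := ((hWc.mono hKW).mono sdiff_subset).to_subtype
  have heq : 𝓝 y = 𝓟 K ⊓ ⨅ w : ↥(K \ {y}), 𝓟 (V w)ᶜ := by
    apply le_antisymm
    · exact le_inf (le_principal_iff.2 hK)
        (le_iInf fun w => le_principal_iff.2 (hVy w w.2.2))
    · refine hKcl.isCompact.le_nhds_of_unique_clusterPt (mem_inf_of_left (mem_principal_self K)) ?_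
      intro w hw hcl
      by_contra hwy
      have hle : 𝓟 K ⊓ ⨅ w : ↥(K \ {y}), 𝓟 (V w)ᶜ ≤ 𝓟 (V w)ᶜ :=
        inf_le_right.trans (iInf_le _ (⟨w, hw, hwy⟩ : ↥(K \ {y})))
      have hmem : w ∈ closure (V w)ᶜ := mem_closure_iff_clusterPt.2 (hcl.mono hle)
      rw [(hVo w hwy).isClosed_compl.closure_eq] at hmem
      exact hmem (hwV w hwy)
  rw [heq]
  infer_instance

theorem Set.Countable.exists_isOpen_countable_superset {X : Type*} [TopologicalSpace X]
    {C : Set X} (hC : C.Countable) (hloc : ∀ y ∈ C, ∃ W ∈ 𝓝 y, W.Countable) :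
    ∃ W, IsOpen W ∧ W.Countable ∧ C ⊆ W := by
  choose! W hW hWc using hloc
  exact ⟨⋃ y ∈ C, interior (W y), isOpen_biUnion fun _ _ => isOpen_interior,
    hC.biUnion fun y hy => (hWc y hy).mono interior_subset,
    fun y hy => mem_biUnion hy (mem_interior_iff_mem_nhds.2 (hW y hy))⟩

theorem metrizableSpace_of_countable_of_compactSpace (X : Type*) [TopologicalSpace X]
    [CompactSpace X] [T2Space X] [Countable X] : MetrizableSpace X := by
  have : FirstCountableTopology X :=
    ⟨fun y => isCountablyGenerated_nhds_of_countable_mem_nhds univ_mem (to_countable univ)⟩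
  have : SecondCountableTopology X := by
    choose B hB using fun y : X => (𝓝 y).exists_antitone_basis
    have hbasis : IsTopologicalBasis (range fun i : X × ℕ => interior (B i.1 i.2)) := by
      refine isTopologicalBasis_of_isOpen_of_nhds ?_ ?_
      · rintro _ ⟨i, rfl⟩
        exact isOpen_interior
      · intro y O hy hO
        obtain ⟨n, -, hn⟩ := (hB y).1.mem_iff.1 (hO.mem_nhds hy)
        exact ⟨_, ⟨(y, n), rfl⟩, mem_interior_iff_mem_nhds.2 ((hB y).1.mem_of_mem trivial),
          interior_subset.trans hn⟩
    exact hbasis.secondCountableTopology (countable_range _)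
  exact metrizableSpace_of_t3_secondCountable X

/-! ### Cantor–Bendixson derivatives -/

theorem cbDerivative_antitone (X : Type u) [TopologicalSpace X] : Antitone (cbDerivative X) :=
  CantorBendixson.iteratedDerivedSet_antitone _

theorem isClosed_cbDerivative (X : Type u) [TopologicalSpace X] (a : Ordinal.{u}) :
    IsClosed (cbDerivative X a) :=
  CantorBendixson.isClosed_iteratedDerivedSet isClosed_univ a

theorem IsScattered.mem_cbDerivative_pointHeight {X : Type u} [TopologicalSpace X]
    (hX : IsScattered X) (x : X) :
    x ∈ cbDerivative X (pointHeight x) \ cbDerivative X (pointHeight x + 1) :=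
  (hX.mem_cbDerivative_diff_iff x _).2 rfl

/-- Near `x`, all other points have smaller height. -/
theorem IsScattered.eventually_pointHeight_lt {X : Type u} [TopologicalSpace X]
    (hX : IsScattered X) (x : X) :
    ∃ V ∈ 𝓝 x, ∀ y ∈ V, y ≠ x → y ∉ cbDerivative X (pointHeight x) ∧
      pointHeight y < pointHeight x := by
  obtain ⟨hx, hx'⟩ := hX.mem_cbDerivative_pointHeight x
  have hacc : ¬ AccPt x (𝓟 (cbDerivative X (pointHeight x))) := by
    intro h
    apply hx'
    rw [cbDerivative, CantorBendixson.iteratedDerivedSet_succ]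
    exact ⟨h, hx⟩
  rw [accPt_iff_nhds] at hacc
  push Not at hacc
  obtain ⟨V, hV, hVx⟩ := hacc
  have hmem : ∀ y ∈ V, y ≠ x → y ∉ cbDerivative X (pointHeight x) :=
    fun y hy hyx hyd => hyx (hVx y ⟨hy, hyd⟩)
  refine ⟨V, hV, fun y hy hyx => ⟨hmem y hy hyx, ?_⟩⟩
  by_contra! hle
  exact hmem y hy hyx (cbDerivative_antitone X hle (hX.mem_cbDerivative_pointHeight y).1)

/-- From a decreasing sequence of infinite sets one can choose distinct points, the `n`-th in the
`n`-th set. -/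
theorem exists_injective_forall_mem_of_antitone {X : Type*} {A : ℕ → Set X} (hA : Antitone A)
    (hinf : ∀ n, (A n).Infinite) : ∃ y : ℕ → X, Function.Injective y ∧ ∀ n, y n ∈ A n := by
  classical
  obtain ⟨f, hf, hlt⟩ := exists_seq_of_forall_finset_exists
    (fun i : ℕ × X => i.2 ∈ A i.1) (fun i j => i.1 < j.1 ∧ i.2 ≠ j.2) (by
      intro s _
      obtain ⟨y, hy, hys⟩ := (hinf (s.sup Prod.fst + 1)).exists_notMem_finset (s.image Prod.snd)
      refine ⟨(s.sup Prod.fst + 1, y), hy, fun i hi => ⟨?_, ?_⟩⟩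
      · exact Nat.lt_succ_of_le (Finset.le_sup (f := Prod.fst) hi)
      · rintro rfl
        exact hys (Finset.mem_image_of_mem _ hi))
  have hmono : StrictMono fun n => (f n).1 := fun m n h => (hlt m n h).1
  refine ⟨fun n => (f n).2, ?_, fun n => hA (hmono.id_le n) (hf n)⟩
  intro m n hmn
  rcases lt_trichotomy m n with h | h | h
  · exact absurd hmn (hlt m n h).2
  · exact h
  · exact absurd hmn.symm (hlt n m h).2

/-- A locally countable set `C`, closed away from `x`, of bounded countable height, no countable
subset of which accumulates at `x`, is countable. For the least `b` such that `C` meets the `b`-th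
derivative in a countable set, that set is covered by a countable open set `W`; if `b ≠ 0`, distinct
points of `C \ W` in derivatives of index approaching `b` accumulate at a point of `C \ W` in the
`b`-th derivative, which is absurd. -/
theorem countable_of_forall_countable_subset_notMem_closure {X : Type u} [TopologicalSpace X]
    [CompactSpace X] {x : X} {C : Set X} {a : Ordinal.{u}} (ha : (Iio a).Countable)
    (hCa : ∀ y ∈ C, y ∉ cbDerivative X a)
    (hcl : ∀ z ∈ closure C, z ≠ x → z ∈ C)
    (hloc : ∀ y ∈ C, ∃ W ∈ 𝓝 y, W.Countable)
    (hfar : ∀ S ⊆ C, S.Countable → x ∉ closure S) : C.Countable := by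
  have haC : (C ∩ cbDerivative X a).Countable := by
    rw [eq_empty_of_forall_notMem fun y (hy : y ∈ C ∩ cbDerivative X a) => hCa y hy.1 hy.2]
    exact countable_empty
  obtain ⟨b, hb, hmin⟩ := exists_minimal_of_wellFoundedLT
    (fun b => (C ∩ cbDerivative X b).Countable) ⟨a, haC⟩
  have hba : b ≤ a := by
    by_contra! h
    exact h.not_ge (hmin haC h.le)
  rcases eq_or_ne b 0 with rfl | hb0
  · simpa [cbDerivative] using hb
  exfalso
  obtain ⟨W, hWo, hWc, hCW⟩ := Set.Countable.exists_isOpen_countable_superset hb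
    fun y hy => hloc y hy.1
  obtain ⟨g, hg⟩ := (ha.mono (Iio_subset_Iio hba)).exists_eq_range
    ⟨0, pos_iff_ne_zero.2 hb0⟩
  have hgb : ∀ n, g n < b := fun n => by
    have : g n ∈ Iio b := hg ▸ mem_range_self n
    exact this
  let A : ℕ → Set X := fun n => (C \ W) ∩ ⋂ i ∈ Iic n, cbDerivative X (g i)
  have hA : Antitone A := fun m n hmn =>
    inter_subset_inter_right _ (biInter_subset_biInter_left (Iic_subset_Iic.2 hmn))
  have hinf : ∀ n, (A n).Infinite := by
    intro n hfin
    obtain ⟨i, hi, hmax⟩ := (finite_Iic n).exists_maximalFor g (Iic n) ⟨n, self_mem_Iic⟩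
    have hsub : C ∩ cbDerivative X (g i) ⊆ W ∪ A n := by
      intro y hy
      by_cases hyW : y ∈ W
      · exact Or.inl hyW
      · refine Or.inr ⟨⟨hy.1, hyW⟩, mem_iInter₂.2 fun k hk => ?_⟩
        refine cbDerivative_antitone X ?_ hy.2
        rcases le_total (g k) (g i) with h | h
        · exact h
        · exact hmax hk h
    exact (hgb i).not_ge (hmin ((hWc.union hfin.countable).mono hsub) (hgb i).le)
  obtain ⟨y, hinj, hy⟩ := exists_injective_forall_mem_of_antitone hA hinf
  have hyC : range y ⊆ C := by
    rintro _ ⟨n, rfl⟩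
    exact (hy n).1.1
  obtain ⟨z, hz⟩ : ∃ z, MapClusterPt z atTop y := by
    obtain ⟨z, -, hz⟩ := isCompact_univ.exists_mapClusterPt (f := atTop) (u := y) (by simp)
    exact ⟨z, hz⟩
  have hzcl : ∀ D : Set X, (∀ n, y n ∈ D) → z ∈ closure D := fun D hD =>
    mem_closure_iff_clusterPt.2 (ClusterPt.mono hz (tendsto_principal.2 (Eventually.of_forall hD)))
  have hzx : z ≠ x := by
    rintro rfl
    exact hfar _ hyC (countable_range y) (hzcl _ mem_range_self)
  have hzC : z ∈ C := hcl z (hzcl C fun n => (hy n).1.1) hzx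
  have hzW : z ∉ W := by
    have := hzcl Wᶜ fun n => (hy n).1.2
    rwa [hWo.isClosed_compl.closure_eq] at this
  refine hzW (hCW ⟨hzC, ?_⟩)
  rw [cbDerivative_eq]
  refine mem_iInter₂.2 fun c hc => ?_
  have hacc : AccPt z (𝓟 (cbDerivative X c)) := by
    obtain ⟨m, rfl⟩ : c ∈ range g := hg ▸ hc
    rw [accPt_iff_nhds]
    intro N hN
    have hev : ∀ᶠ n in atTop, m ≤ n ∧ y n ≠ z := by
      refine (eventually_ge_atTop m).and ?_
      have := hinj.tendsto_cofinite.eventually ((finite_singleton z).eventually_cofinite_notMem)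
      rwa [Nat.cofinite_eq_atTop] at this
    obtain ⟨n, hnN, hmn, hnz⟩ := ((hz.frequently hN).and_eventually hev).exists
    exact ⟨y n, ⟨hnN, mem_iInter₂.1 (hy n).2 m hmn⟩, hnz⟩
  exact ⟨(isClosed_iff_derivedSet_subset _).1 (isClosed_cbDerivative X c) hacc, hacc⟩

/-! ### Points omitted by a base indexed by compact sets -/

/-- The points of `V` omitted by some `U q` with `q` a compact subset of `O`. -/
def omittedPoints {X M : Type*} [TopologicalSpace M] (U : Compacts M → Set X) (V : Set X)
    (O : Set M) : Set X :=
  {y ∈ V | ∃ q : Compacts M, (q : Set M) ⊆ O ∧ y ∉ U q}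

/-- The local step: near each compact set `p`, the base at `x` omits only countably many points
of `V`. The points other than `x` adherent to the sets omitted near `p` form a countable set by
`countable_of_forall_countable_subset_notMem_closure`; a countable open set around it contains
the points omitted sufficiently near `p`. -/
theorem exists_countable_omittedPoints_thickening {X : Type u} [TopologicalSpace X]
    [CompactSpace X] [T2Space X] {M : Type v} [PseudoMetricSpace M] {x : X} {a : Ordinal.{u}}
    (ha : (Iio a).Countable) {V : Set X} (hV : IsClosed V)
    (hVa : ∀ y ∈ V, y ≠ x → y ∉ cbDerivative X a)
    (hloc : ∀ y ∈ V, y ≠ x → ∃ W ∈ 𝓝 y, W.Countable)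
    {U : Compacts M → Set X} (hUx : ∀ q, U q ∈ 𝓝 x) (hU : ∀ p q, p ≤ q → U q ⊆ U p)
    (p : Compacts M) :
    ∃ n : ℕ, (omittedPoints U V (Metric.thickening (1 / ((n : ℝ) + 1)) p)).Countable := by
  set D : ℕ → Set X := fun n => omittedPoints U V (Metric.thickening (1 / ((n : ℝ) + 1)) p)
  set C : Set X := (⋂ n, closure (D n)) \ {x}
  have hCcl : closure C ⊆ ⋂ n, closure (D n) :=
    closure_minimal sdiff_subset (isClosed_iInter fun _ => isClosed_closure)
  have hDV : ∀ n, closure (D n) ⊆ V := fun n => closure_minimal (fun y hy => hy.1) hV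
  have hCV : ∀ y ∈ C, y ∈ V ∧ y ≠ x := fun y hy => ⟨hDV 0 (mem_iInter.1 hy.1 0), hy.2⟩
  have hCloc : ∀ y ∈ C, ∃ W ∈ 𝓝 y, W.Countable :=
    fun y hy => hloc y (hCV y hy).1 (hCV y hy).2
  have hfar : ∀ S ⊆ C, S.Countable → x ∉ closure S := by
    intro S hSC hS
    rcases S.eq_empty_or_nonempty with rfl | hne
    · simp
    obtain ⟨y, rfl⟩ := hS.exists_eq_range hne
    have hyC : ∀ k, y k ∈ C := fun k => hSC (mem_range_self k)
    have hbas : ∀ k, ∃ N : ℕ → Set X, (𝓝 (y k)).HasAntitoneBasis N := by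
      intro k
      obtain ⟨W, hW, hWc⟩ := hCloc _ (hyC k)
      have := isCountablyGenerated_nhds_of_countable_mem_nhds hW hWc
      exact (𝓝 (y k)).exists_antitone_basis
    choose N hN using hbas
    have hz : ∀ k j, ∃ z, z ∈ N k j ∧ z ∈ D j := fun k j =>
      mem_closure_iff_nhds.1 (mem_iInter.1 (hyC k).1 j) _ ((hN k).1.mem_of_mem trivial)
    choose z hzN hzD using hz
    obtain ⟨q, hq⟩ := exists_forall_notMem_of_thickening hU p z fun k j _ => (hzD k j).2
    have hlim : ∀ k, Tendsto (z k) atTop (𝓝 (y k)) := fun k => (hN k).tendsto (hzN k)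
    have hsub : range y ⊆ (interior (U q))ᶜ := by
      rintro _ ⟨k, rfl⟩
      refine isOpen_interior.isClosed_compl.mem_of_tendsto (hlim k) ?_
      filter_upwards [eventually_ge_atTop k] with j hj
      exact fun h => hq k j hj (interior_subset h)
    intro hx
    exact closure_minimal hsub isOpen_interior.isClosed_compl hx
      (mem_interior_iff_mem_nhds.2 (hUx q))
  have hCc : C.Countable := countable_of_forall_countable_subset_notMem_closure ha
    (fun y hy => hVa y (hCV y hy).1 (hCV y hy).2) (fun z hz hzx => ⟨hCcl hz, hzx⟩) hCloc hfar
  obtain ⟨W, hWo, hWc, hCW⟩ := hCc.exists_isOpen_countable_superset hCloc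
  by_contra! hno
  have hy : ∀ n, ∃ y, y ∈ D n ∧ y ∉ W := by
    intro n
    by_contra! h
    exact hno n (hWc.mono h)
  choose y hyD hyW using hy
  obtain ⟨q, hq⟩ := exists_forall_notMem_of_thickening hU p (fun _ j => y j)
    fun k j _ => (hyD j).2
  obtain ⟨z, -, hz⟩ := isCompact_univ.exists_mapClusterPt (f := atTop) (u := y) (by simp)
  have hzcl : ∀ E : Set X, (∀ᶠ n in atTop, y n ∈ E) → z ∈ closure E := fun E hE =>
    mem_closure_iff_clusterPt.2 (ClusterPt.mono hz (tendsto_principal.2 hE))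
  have hzx : z ≠ x := by
    rintro rfl
    obtain ⟨n, hn⟩ := (hz.frequently (hUx q)).exists
    exact hq n n le_rfl hn
  have hzW : z ∉ W := by
    have := hzcl Wᶜ (Eventually.of_forall hyW)
    rwa [hWo.isClosed_compl.closure_eq] at this
  refine hzW (hCW ⟨mem_iInter.2 fun n => hzcl _ ?_, hzx⟩)
  filter_upwards [eventually_ge_atTop n] with m hm
  obtain ⟨hmV, q', hq', hmq'⟩ := hyD m
  refine ⟨hmV, q', hq'.trans (Metric.thickening_mono ?_ _), hmq'⟩
  gcongr

/-- If the base at `x` omits only countably many points of `V` near each compact set, then `V` is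
countable: countably many open sets of `M` suffice to witness this. -/
theorem countable_of_countable_omittedPoints_thickening {X : Type u} [TopologicalSpace X]
    [T1Space X] {M : Type v} [PseudoMetricSpace M] [SeparableSpace M] {x : X} {V : Set X}
    {U : Compacts M → Set X} (hUx : (𝓝 x).HasBasis (fun _ => True) U)
    (h : ∀ p : Compacts M, ∃ n : ℕ,
      (omittedPoints U V (Metric.thickening (1 / ((n : ℝ) + 1)) p)).Countable) :
    V.Countable := by
  have : SecondCountableTopology M := UniformSpace.secondCountable_of_separable M
  obtain ⟨B, hBc, -, hB⟩ := exists_countable_basis M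
  let 𝒪 : Set (Set (Set M)) := {F | F.Finite ∧ F ⊆ B ∧ (omittedPoints U V (⋃₀ F)).Countable}
  have h𝒪 : 𝒪.Countable := (countable_ofPred_finite_subset hBc).mono fun F hF => And.intro hF.1 hF.2.1
  refine ((countable_singleton x).union
    (h𝒪.biUnion fun F hF => hF.2.2)).mono fun y hy => ?_
  by_cases hyx : y = x
  · exact Or.inl hyx
  refine Or.inr ?_
  obtain ⟨p, -, hp⟩ := hUx.mem_iff.1 (isOpen_compl_singleton.mem_nhds (Ne.symm hyx) : {y}ᶜ ∈ 𝓝 x)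
  obtain ⟨n, hn⟩ := h p
  obtain ⟨F, hFB, hF, hpF, hFn⟩ : ∃ F ⊆ B, F.Finite ∧ (p : Set M) ⊆ ⋃₀ F ∧
      ⋃₀ F ⊆ Metric.thickening (1 / ((n : ℝ) + 1)) (p : Set M) := by
    have hex : ∀ m ∈ (p : Set M), ∃ b ∈ B, m ∈ b ∧
        b ⊆ Metric.thickening (1 / ((n : ℝ) + 1)) (p : Set M) := fun m hm =>
      hB.exists_subset_of_mem_open (Metric.self_subset_thickening (by positivity) _ hm)
        Metric.isOpen_thickening
    choose! b hbB hmb hb using hex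
    obtain ⟨t, htp, ht, hpt⟩ := p.isCompact.elim_finite_subcover_image (b := (p : Set M))
      (fun m hm => hB.isOpen (hbB m hm)) fun m hm => mem_biUnion hm (hmb m hm)
    refine ⟨b '' t, image_subset_iff.2 fun m hm => hbB m (htp hm), ht.image b, ?_, ?_⟩
    · rwa [sUnion_image]
    · rw [sUnion_image]
      exact iUnion₂_subset fun m hm => hb m (htp hm)
  refine mem_biUnion (x := F) ⟨hF, hFB, hn.mono ?_⟩ ⟨hy, p, hpF, fun hyp => hp hyp rfl⟩
  rintro w ⟨hw, q, hq, hwq⟩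
  exact ⟨hw, q, hq.trans hFn, hwq⟩

/-! ### Countability and metrizability -/

/-- Induction on the height of the point. -/
theorem IsScattered.exists_countable_mem_nhds {X : Type u} [TopologicalSpace X] [CompactSpace X]
    [T2Space X] (hX : IsScattered X) {M : Type v} [PseudoMetricSpace M] [SeparableSpace M]
    (hbase : HasPBase (Compacts M) X) (hheight : ∀ x : X, (Iio (pointHeight x)).Countable)
    (x : X) : ∃ W ∈ 𝓝 x, W.Countable := by
  induction hx : pointHeight x using WellFoundedLT.induction generalizing x with
  | ind a ih =>
    subst hx
    obtain ⟨V, hV, hVlt⟩ := hX.eventually_pointHeight_lt x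
    obtain ⟨K, hK, hKcl, hKV⟩ := exists_mem_nhds_isClosed_subset hV
    obtain ⟨U, hUx, hU⟩ := hbase x
    exact ⟨K, hK, countable_of_countable_omittedPoints_thickening hUx
      (exists_countable_omittedPoints_thickening (hheight x) hKcl
        (fun y hy hyx => (hVlt y (hKV hy) hyx).1)
        (fun y hy hyx => ih _ (hVlt y (hKV hy) hyx).2 y rfl)
        (fun q => hUx.mem_of_mem trivial) hU)⟩

theorem countable_Iio_pointHeight {X : Type u} [TopologicalSpace X]
    (hheight : (scatteredHeight X).card ≤ Cardinal.aleph0) (x : X) :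
    (Iio (pointHeight x)).Countable := by
  have hle : pointHeight x ≤ scatteredHeight X :=
    le_ciSup (f := fun x : X => pointHeight x) Ordinal.bddAbove_of_small x
  rw [← Cardinal.le_aleph0_iff_set_countable, Cardinal.mk_Iio_ordinal, Cardinal.lift_le_aleph0]
  exact (Ordinal.card_le_card hle).trans hheight

theorem mainTheorem1 (X : Type u) [TopologicalSpace X] [CompactSpace X] [T2Space X]
    (hX : IsScattered X) (hheight : (scatteredHeight X).card ≤ Cardinal.aleph0)
    (M : Type v) [MetricSpace M] [TopologicalSpace.SeparableSpace M]
    (hbase : HasPBase (TopologicalSpace.Compacts M) X) :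
    Countable X ∧ TopologicalSpace.MetrizableSpace X := by
  have hloc := hX.exists_countable_mem_nhds hbase (countable_Iio_pointHeight hheight)
  choose W hW hWc using hloc
  obtain ⟨t, ht⟩ := finite_cover_nhds hW
  have hXc : Countable X := countable_univ_iff.1
    (ht ▸ t.countable_toSet.biUnion fun x _ => hWc x)
  exact ⟨hXc, metrizableSpace_of_countable_of_compactSpace X⟩
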